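/- A project requires an investment $I>0$; the risk-free rate is $r>0$. If the entrepreneur exerts effort $e\in[0,\bar e]$ ($\bar e>0$), at cost $C(e)\ge 0$ with $C$ differentiable on $[0,\bar e]$, the profit has a density $\phi(\cdot|e)$ on $[0,1]$, where $\phi(x|e)>0$ for all $x\in[0,1]$ and $e\in[0,\bar e]$, $\phi(x|\cdot)$ is differentiable on $[0,\bar e]$ for every $x\in[0,1]$, with derivative $\phi_e(x|e)$, and there is an integrable $g$ on $[0,1]$ with $|\phi_e(x|e)|\le g(x)$ for all $x$ and $e$. (Derivatives at the end points of $[0,\bar e]$ are one-sided.) Let $\mathcal I$ be the set of securities: nondecreasing, right-continuous functions $H:[0,1]\to\mathbb R$ with $0\le H(x)\le x$ for all $x$. The entrepreneur's problem is to maximize $$\int_0^1 (x-H(x))\,\phi(x|e)\,dx-C(e)$$ over $H\in\mathcal I$ and $e\in[0,\bar e]$ subject to $$\int_0^1 (x-H(x))\,\phi_e(x|e)\,dx=C'(e)\quad\text{(FOC)}\qquad\text{and}\qquad \int_0^1 H(x)\,\phi(x|e)\,dx\ge(1+r)I .$$ Assume that the first-order approach is valid, i.e. for every $H\in\mathcal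 I$, every $e\in[0,\bar e]$ that satisfies (FOC) maximizes $\int_0^1 (x-H(x))\,\phi(x|e')\,dx-C(e')$ over $e'\in[0,\bar e]$; and assume that some pair $(H,e)$ satisfies all the constraints. No monotone likelihood ratio property is assumed. A security $H\in\mathcal I$ is a contingent debt contract if there is a countable (possibly finite or empty) collection of intervals $[\underline x_n,\overline x_n)$, with $0\le\underline x_n<1$, $\underline x_n<\overline x_n$, understood as subsets of $[0,1]$ (where $\overline x_n>1$ is allowed, so that an interval may contain $1$), such that $H$ is constant on each of them, $H(x)=x$ for all $x\in[0,1]$ outside their union, and $H(\underline x_n)\ne H(\underline x_m)$ for $n\neq m$. Its face values are $d_n=H(\underline x_n)$; $d_n$ is non-defaultable if $d_n<x$ for all $x\in[\underline x_n,\overline x_n)\cap[0,1]$. Then there are a contingent debt contract $H$ with at most two non-defaultable face values and an effort $e\in[0,\bar e]$ such that $(H,e)$ solves the entrepreneur's problem. -/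

import Mathlib

open Set MeasureTheory

/-- The interval of monotone functions on `[0, 1]` between `F` and `G`: the nondecreasing,
right-continuous functions `H` on `[0, 1]` with `F ≤ H ≤ G` there.  A function on `[0, 1]` is
represented by a function on `ℝ`, whose values outside `[0, 1]` play no role. -/
def monotoneInterval (F G : ℝ → ℝ) : Set (ℝ → ℝ) :=
  {H | MonotoneOn H (Icc 0 1) ∧
    (∀ x ∈ Ico (0 : ℝ) 1, ContinuousWithinAt H (Ici x) x) ∧
    ∀ x ∈ Icc (0 : ℝ) 1, F x ≤ H x ∧ H x ≤ G x}

/-- Securities: nondecreasing, right-continuous, with limited liability `0 ≤ H x ≤ x`. -/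
def securities : Set (ℝ → ℝ) := monotoneInterval (fun _ => 0) (fun x => x)

/-- The primitives of the security design problem under moral hazard: the effort levels are
`e ∈ [0, ebar]`, the cost of effort `e` is `C e`, the profit given effort `e` has density `φ e`
on `[0, 1]`, the project needs the investment `inv`, and `r` is the risk-free rate of return.
All derivatives in effort are derivatives on `[0, ebar]` (one-sided at the end points). -/
structure MoralHazard where
  ebar : ℝ
  ebar_pos : 0 < ebar
  inv : ℝ
  inv_pos : 0 < inv
  r : ℝ
  r_pos : 0 < r
  C : ℝ → ℝ
  C_nonneg : ∀ e ∈ Icc 0 ebar, 0 ≤ C e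
  C_differentiable : DifferentiableOn ℝ C (Icc 0 ebar)
  φ : ℝ → ℝ → ℝ
  φ_integrable : ∀ e ∈ Icc 0 ebar, IntegrableOn (φ e) (Icc 0 1)
  φ_integral : ∀ e ∈ Icc 0 ebar, ∫ x in (0 : ℝ)..1, φ e x = 1
  φ_pos : ∀ e ∈ Icc 0 ebar, ∀ x ∈ Icc (0 : ℝ) 1, 0 < φ e x
  φ_differentiable : ∀ x ∈ Icc (0 : ℝ) 1, DifferentiableOn ℝ (fun e => φ e x) (Icc 0 ebar)
  φ_dominated : ∃ g : ℝ → ℝ, IntegrableOn g (Icc 0 1) ∧ ∀ e ∈ Icc 0 ebar,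
    ∀ x ∈ Icc (0 : ℝ) 1, |derivWithin (fun t => φ t x) (Icc 0 ebar) e| ≤ g x

namespace MoralHazard

variable (M : MoralHazard)

/-- The derivative `φ_e(x | e)` of the density in effort. -/
noncomputable def φe (e x : ℝ) : ℝ := derivWithin (fun t => M.φ t x) (Icc 0 M.ebar) e

/-- The marginal cost of effort `C'(e)`. -/
noncomputable def C' (e : ℝ) : ℝ := derivWithin M.C (Icc 0 M.ebar) e

/-- The entrepreneur's expected payoff from security `H` and effort `e`. -/
noncomputable def payoff (H : ℝ → ℝ) (e : ℝ) : ℝ :=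
  (∫ x in (0 : ℝ)..1, (x - H x) * M.φ e x) - M.C e

/-- Given the security `H`, the effort level `e` solves the entrepreneur's effort problem. -/
def SolvesEffort (H : ℝ → ℝ) (e : ℝ) : Prop :=
  e ∈ Icc 0 M.ebar ∧ ∀ e' ∈ Icc 0 M.ebar, M.payoff H e' ≤ M.payoff H e

/-- The first-order condition of the effort problem. -/
def FOC (H : ℝ → ℝ) (e : ℝ) : Prop :=
  ∫ x in (0 : ℝ)..1, (x - H x) * M.φe e x = M.C' e

/-- The constraints of the entrepreneur's problem. -/
def Feasible (H : ℝ → ℝ) (e : ℝ) : Prop :=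
  H ∈ securities ∧ e ∈ Icc 0 M.ebar ∧ M.FOC H e ∧
    (1 + M.r) * M.inv ≤ ∫ x in (0 : ℝ)..1, H x * M.φ e x

/-- `(H, e)` solves the entrepreneur's problem: it is feasible and attains the maximal payoff. -/
def Solves (H : ℝ → ℝ) (e : ℝ) : Prop :=
  M.Feasible H e ∧ ∀ H' e', M.Feasible H' e' → M.payoff H' e' ≤ M.payoff H e

end MoralHazard

/-- `H` is a contingent debt contract with the intervals `[a n, b n)`, understood as subsets of
`[0, 1]`: `b n > 1` is allowed, so that an interval may contain the highest profit `1` (as it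
must for a standard debt contract). -/
structure IsContingentDebtOn {ι : Type} (H : ℝ → ℝ) (a b : ι → ℝ) : Prop where
  security : H ∈ securities
  endpoints : ∀ n, 0 ≤ a n ∧ a n < 1 ∧ a n < b n
  constant : ∀ n, ∀ x ∈ Ico (a n) (b n) ∩ Icc 0 1, H x = H (a n)
  eq_self : ∀ x ∈ Icc (0 : ℝ) 1, (∀ n, x ∉ Ico (a n) (b n)) → H x = x
  distinct : ∀ n m, n ≠ m → H (a n) ≠ H (a m)

/-- The non-defaultable face values: those `H (a n)` that are below every profit in the
interval `[a n, b n)` in which they are in effect. -/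
def nonDefaultable {ι : Type} (H : ℝ → ℝ) (a b : ι → ℝ) : Set ℝ :=
  {d | ∃ n, d = H (a n) ∧ ∀ x ∈ Ico (a n) (b n) ∩ Icc 0 1, d < x}

/-- `H` is a contingent debt contract with countably many face values, at most `k` of which
are non-defaultable. -/
def IsContingentDebt (H : ℝ → ℝ) (k : ℕ) : Prop :=
  ∃ (ι : Type) (a b : ι → ℝ), Countable ι ∧ IsContingentDebtOn H a b ∧
    (nonDefaultable H a b).encard ≤ k

/-! Once the effort `e` is fixed, a security enters the payoff and the constraints only through its
integrals against the two weights `φ e` and `φe e`. So it suffices to solve the problem with some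
security and then to replace that security, at the same effort, by a contingent debt contract with
the same two integrals.

Replacement: by Helly's theorem, some security `H` maximizes `∫ H²` among those with the prescribed
integrals against `k` weights. Call a value `v` of `H` strict if `H v < v`. Around a strict value,
`H` can be moved up or down by a small tent function of `H` itself and remain a security. With `k +
1` strict values, some nonzero combination `p` of tents is orthogonal to all `k` weights, and then
`H + p` and `H - p` are competitors whose second moments average to `∫ H² + ∫ p² > ∫ H²`. Hence at
most `k` values are strict (`encard_strictFaceValues_le_of_forall_integral_sq_le`). Every
non-defaultable face value is strict, and finiteness of the strict values makes the level sets off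
the diagonal half-open intervals (`isContingentDebt_of_encard_strictFaceValues_le`).

Existence: a maximizing sequence converges by Helly and compactness of the efforts. The delicate
point is the FOC in the limit, as `φe` need not be continuous in effort; there the first-order
approach is used a second time, through the shape it forces on the payoff
(`le_of_mem_uIcc_of_forall_critical_isMax`). -/

open Filter Topology

/-! ### Compactness of monotone functions and securities -/

/-- **Helly's selection theorem** for uniformly bounded sequences of monotone functions: the limit
may be taken right-continuous, and the convergence is pointwise off a countable set. -/
theorem exists_subseq_tendsto_of_monotone {u : ℕ → ℝ → ℝ} {a b : ℝ} (hmono : ∀ n, Monotone (u n))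
    (hmem : ∀ n x, u n x ∈ Icc a b) :
    ∃ (F : ℝ → ℝ) (ψ : ℕ → ℕ), StrictMono ψ ∧ Monotone F ∧
      (∀ x, ContinuousWithinAt F (Ici x) x) ∧
      (∀ x, ContinuousAt F x → Tendsto (fun n => u (ψ n) x) atTop (𝓝 (F x))) ∧
      (∀ x c, (∀ᶠ y in 𝓝[>] x, ∀ᶠ n in atTop, u n y ≤ c y) → ContinuousAt c x → F x ≤ c x) ∧
      ∀ x, F x ∈ Icc a b := by
  -- Compactness of a countable product replaces the diagonal argument over the rationals.
  have hK : IsCompact (Set.pi univ fun _ : ℚ => Icc a b) := isCompact_univ_pi fun _ => isCompact_Icc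
  obtain ⟨L, hL, ψ, hψ, hlim⟩ := hK.tendsto_subseq (x := fun n (q : ℚ) => u n q)
    fun n q _ => hmem n q
  have hlim' : ∀ q : ℚ, Tendsto (fun n => u (ψ n) q) atTop (𝓝 (L q)) := fun q =>
    (tendsto_pi_nhds.1 hlim) q
  have hLab : ∀ q, L q ∈ Icc a b := fun q => hL q trivial
  -- The limit at `x` is the infimum of `L` over the rationals strictly above `x`; strictness makes
  -- it right-continuous.
  set S : ℝ → Set ℝ := fun x => L '' {q : ℚ | x < q} with hS
  have hSne : ∀ x, (S x).Nonempty := fun x => by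
    obtain ⟨q, hq⟩ := exists_rat_gt x
    exact ⟨L q, q, hq, rfl⟩
  have hSbdd : ∀ x, BddBelow (S x) := fun x => ⟨a, by
    rintro _ ⟨q, -, rfl⟩
    exact (hLab q).1⟩
  have hle : ∀ {x : ℝ} {q : ℚ}, x < q → sInf (S x) ≤ L q := fun hq =>
    csInf_le (hSbdd _) ⟨_, hq, rfl⟩
  have hlt : ∀ {x c : ℝ}, sInf (S x) < c → ∃ q : ℚ, x < q ∧ L q < c := fun {x c} h => by
    obtain ⟨_, ⟨q, hq, rfl⟩, h'⟩ := exists_lt_of_csInf_lt (hSne x) h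
    exact ⟨q, hq, h'⟩
  have hmonoF : Monotone fun x => sInf (S x) := fun x y hxy =>
    csInf_le_csInf (hSbdd x) (hSne y) (image_mono fun q (hq : y < q) => hxy.trans_lt hq)
  refine ⟨fun x => sInf (S x), ψ, hψ, hmonoF, fun x => ?_, fun x hx => ?_, fun x c hc hcx => ?_,
    fun x => ?_⟩
  · refine tendsto_order.2 ⟨fun c hc => ?_, fun c hc => ?_⟩
    · filter_upwards [self_mem_nhdsWithin] with y hy using hc.trans_le (hmonoF hy)
    · obtain ⟨q, hq, hqc⟩ := hlt hc
      filter_upwards [mem_nhdsWithin_of_mem_nhds (Iio_mem_nhds hq)] with y hy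
        using (hle hy).trans_lt hqc
  · refine tendsto_order.2 ⟨fun c hc => ?_, fun c hc => ?_⟩
    · have h1 : ∀ᶠ y in 𝓝[<] x, c < sInf (S y) :=
        (hx.eventually (lt_mem_nhds hc)).filter_mono nhdsWithin_le_nhds
      obtain ⟨y, hy, hyx⟩ := (h1.and self_mem_nhdsWithin).exists
      replace hyx : y < x := hyx
      obtain ⟨q, hq, hqx⟩ := exists_rat_btwn hyx
      filter_upwards [(hlim' q).eventually (lt_mem_nhds (hy.trans_le (hle hq)))] with n hn
        using hn.trans_le (hmono _ hqx.le)
    · obtain ⟨q, hq, hqc⟩ := hlt hc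
      filter_upwards [(hlim' q).eventually (gt_mem_nhds hqc)] with n hn
        using (hmono _ hq.le).trans_lt hn
  -- The sequence may fail to converge at `x`, so the bound is passed to the limit at a rational
  -- just to the right of `x`.
  · refine le_of_forall_pos_le_add fun ε hε => ?_
    have h1 := (hc.and ((hcx.eventually (gt_mem_nhds (lt_add_of_pos_right _ hε))).filter_mono
      nhdsWithin_le_nhds))
    obtain ⟨y, hy, h2⟩ := (mem_nhdsGT_iff_exists_Ioo_subset).1 h1
    obtain ⟨q, hq, hqy⟩ := exists_rat_btwn (mem_Ioi.1 hy)
    obtain ⟨h3, h4⟩ := h2 ⟨hq, hqy⟩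
    exact (hle hq).trans ((le_of_tendsto (hlim' q) (hψ.tendsto_atTop.eventually h3)).trans h4.le)
  · obtain ⟨_, q, -, rfl⟩ := hSne x
    exact ⟨le_csInf (hSne x) fun _ ⟨q, _, h⟩ => h ▸ (hLab q).1,
      (csInf_le (hSbdd x) (hSne x).some_mem).trans (by
        obtain ⟨q, -, h⟩ := (hSne x).some_mem
        exact h ▸ (hLab q).2)⟩

theorem securities_le_one {H : ℝ → ℝ} (hH : H ∈ securities) {x : ℝ} (hx : x ∈ Icc (0 : ℝ) 1) :
    H x ≤ 1 := (hH.2.2 x hx).2.trans hx.2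

/-- Securities are sequentially compact for almost everywhere convergence. -/
theorem exists_subseq_tendsto_of_mem_securities {u : ℕ → ℝ → ℝ} (hu : ∀ n, u n ∈ securities) :
    ∃ F ∈ securities, ∃ ψ : ℕ → ℕ, StrictMono ψ ∧
      ∀ᵐ x, x ∈ uIoc (0 : ℝ) 1 → Tendsto (fun n => u (ψ n) x) atTop (𝓝 (F x)) := by
  -- Composing with the retraction of `ℝ` onto `[0, 1]` makes securities monotone on the whole line.
  have hcl : ∀ x : ℝ, max 0 (min x 1) ∈ Icc (0 : ℝ) 1 := fun x =>
    ⟨le_max_left _ _, max_le zero_le_one (min_le_right _ _)⟩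
  have hcl' : ∀ x ∈ Icc (0 : ℝ) 1, max 0 (min x 1) = x := fun x hx => by
    rw [min_eq_left hx.2, max_eq_right hx.1]
  obtain ⟨F, ψ, hψ, hF, hright, hlim, hupper, hmem⟩ := exists_subseq_tendsto_of_monotone
    (u := fun n x => u n (max 0 (min x 1))) (a := 0) (b := 1)
    (fun n x y hxy => (hu n).1 (hcl x) (hcl y) (by gcongr))
    (fun n x => ⟨((hu n).2.2 _ (hcl x)).1, securities_le_one (hu n) (hcl x)⟩)
  refine ⟨F, ⟨hF.monotoneOn _, fun x _ => hright x, fun x hx => ⟨(hmem x).1, ?_⟩⟩, ψ, hψ, ?_⟩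
  · have := hupper x (fun y => max 0 (min y 1))
      (Eventually.of_forall fun y => Eventually.of_forall fun n => ((hu n).2.2 _ (hcl y)).2)
      (by fun_prop)
    simpa [hcl' x hx] using this
  · have h0 := hF.countable_not_continuousAt.ae_notMem volume
    filter_upwards [h0] with x hx hx1
    rw [uIoc_of_le zero_le_one] at hx1
    have := hlim x (not_not.1 hx)
    simpa only [hcl' x (Ioc_subset_Icc_self hx1)] using this

/-! ### Integrals of securities against integrable weights -/

theorem aestronglyMeasurable_of_mem_securities {H : ℝ → ℝ} (hH : H ∈ securities) :
    AEStronglyMeasurable H (volume.restrict (uIoc 0 1)) := by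
  rw [uIoc_of_le zero_le_one]
  exact (aemeasurable_restrict_of_monotoneOn measurableSet_Ioc
    (hH.1.mono Ioc_subset_Icc_self)).aestronglyMeasurable

theorem norm_le_one_of_mem_securities {H : ℝ → ℝ} (hH : H ∈ securities) {x : ℝ}
    (hx : x ∈ uIoc (0 : ℝ) 1) : ‖H x‖ ≤ 1 := by
  rw [uIoc_of_le zero_le_one] at hx
  have hx := Ioc_subset_Icc_self hx
  rw [Real.norm_of_nonneg (hH.2.2 x hx).1]
  exact securities_le_one hH hx

theorem norm_sub_le_one_of_mem_securities {H : ℝ → ℝ} (hH : H ∈ securities) {x : ℝ}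
    (hx : x ∈ uIoc (0 : ℝ) 1) : ‖x - H x‖ ≤ 1 := by
  rw [uIoc_of_le zero_le_one] at hx
  have h := hH.2.2 x (Ioc_subset_Icc_self hx)
  rw [Real.norm_of_nonneg (sub_nonneg.2 h.2)]
  linarith [hx.2, h.1]

theorem IntervalIntegrable.bdd_mul_of_norm_le_one {f w : ℝ → ℝ}
    (hw : IntervalIntegrable w volume 0 1)
    (hf : AEStronglyMeasurable f (volume.restrict (uIoc 0 1)))
    (hf1 : ∀ x ∈ uIoc (0 : ℝ) 1, ‖f x‖ ≤ 1) :
    IntervalIntegrable (fun x => f x * w x) volume 0 1 := by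
  refine hw.mono_fun (hf.mul hw.aestronglyMeasurable_restrict_uIoc) ?_
  filter_upwards [ae_restrict_mem measurableSet_uIoc] with x hx
  rw [norm_mul]
  exact mul_le_of_le_one_left (norm_nonneg _) (hf1 x hx)

theorem intervalIntegrable_mul_of_mem_securities {H w : ℝ → ℝ} (hH : H ∈ securities)
    (hw : IntervalIntegrable w volume 0 1) :
    IntervalIntegrable (fun x => H x * w x) volume 0 1 :=
  hw.bdd_mul_of_norm_le_one (aestronglyMeasurable_of_mem_securities hH)
    fun _ => norm_le_one_of_mem_securities hH

theorem intervalIntegrable_sub_mul_of_mem_securities {H w : ℝ → ℝ} (hH : H ∈ securities)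
    (hw : IntervalIntegrable w volume 0 1) :
    IntervalIntegrable (fun x => (x - H x) * w x) volume 0 1 :=
  hw.bdd_mul_of_norm_le_one (f := fun x => x - H x)
    (aestronglyMeasurable_id.sub (aestronglyMeasurable_of_mem_securities hH))
    fun _ => norm_sub_le_one_of_mem_securities hH

theorem intervalIntegral_sub_mul_of_mem_securities {H w : ℝ → ℝ} (hH : H ∈ securities)
    (hw : IntervalIntegrable w volume 0 1) :
    ∫ x in (0 : ℝ)..1, (x - H x) * w x =
      (∫ x in (0 : ℝ)..1, x * w x) - ∫ x in (0 : ℝ)..1, H x * w x := by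
  simp_rw [sub_mul]
  refine intervalIntegral.integral_sub (hw.bdd_mul_of_norm_le_one (f := fun x => x)
    aestronglyMeasurable_id fun x hx => ?_)
    (intervalIntegrable_mul_of_mem_securities hH hw)
  rw [uIoc_of_le zero_le_one] at hx
  rw [Real.norm_of_nonneg hx.1.le]
  exact hx.2

/-- Dominated convergence for securities integrated against converging weights. -/
theorem tendsto_integral_mul_of_mem_securities {u : ℕ → ℝ → ℝ} {F : ℝ → ℝ}
    (hu : ∀ n, u n ∈ securities)
    (hlim : ∀ᵐ x, x ∈ uIoc (0 : ℝ) 1 → Tendsto (fun n => u n x) atTop (𝓝 (F x)))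
    {w : ℕ → ℝ → ℝ} {v bound : ℝ → ℝ} (hw : ∀ n, IntervalIntegrable (w n) volume 0 1)
    (hbound : IntervalIntegrable bound volume 0 1)
    (hle : ∀ n, ∀ x ∈ uIoc (0 : ℝ) 1, ‖w n x‖ ≤ bound x)
    (hwv : ∀ x ∈ uIoc (0 : ℝ) 1, Tendsto (fun n => w n x) atTop (𝓝 (v x))) :
    Tendsto (fun n => ∫ x in (0 : ℝ)..1, u n x * w n x) atTop
      (𝓝 (∫ x in (0 : ℝ)..1, F x * v x)) := by
  refine intervalIntegral.tendsto_integral_filter_of_dominated_convergence bound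
    (Eventually.of_forall fun n =>
      (intervalIntegrable_mul_of_mem_securities (hu n) (hw n)).aestronglyMeasurable_restrict_uIoc)
    (Eventually.of_forall fun n => Eventually.of_forall fun x hx => ?_) hbound ?_
  · rw [norm_mul]
    exact (mul_le_of_le_one_left (norm_nonneg _) (norm_le_one_of_mem_securities (hu n) hx)).trans
      (hle n x hx)
  · filter_upwards [hlim] with x hx hx1 using (hx hx1).mul (hwv x hx1)

/-! ### Contingent debt from finitely many strict face values -/

/-- The values of `H` on `[0, 1]` at which, taken as arguments, `H` lies below the diagonal. -/
def strictFaceValues (H : ℝ → ℝ) : Set ℝ :=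
  {v | (∃ x ∈ Icc (0 : ℝ) 1, H x = v) ∧ H v < v}

/-- A security equal to `1` at `1` with at most `k` face values below the diagonal is a
contingent debt contract whose intervals are its level sets off the diagonal. -/
theorem isContingentDebt_of_encard_strictFaceValues_le {H : ℝ → ℝ} (hH : H ∈ securities)
    (h1 : H 1 = 1) {k : ℕ} (hk : (strictFaceValues H).encard ≤ k) : IsContingentDebt H k := by
  have hmono := hH.1
  have hfin : (strictFaceValues H).Finite := finite_of_encard_le_coe hk
  -- `R` contains all face values, defaultable or not. The interval of `v` runs from the infimum of
  -- its level set `A v` to the infimum of `B v`, where `H` exceeds `v`.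
  set R : Set ℝ := {v | ∃ x ∈ Icc (0 : ℝ) 1, H x = v ∧ v < x} with hR
  set A : ℝ → Set ℝ := fun v => {x ∈ Icc (0 : ℝ) 1 | H x = v} with hA
  set B : ℝ → Set ℝ := fun v => {x ∈ Icc (0 : ℝ) 1 | v < H x} with hB
  have hAbdd : ∀ v, BddBelow (A v) := fun v => ⟨0, fun x hx => hx.1.1⟩
  have hBbdd : ∀ v, BddBelow (B v) := fun v => ⟨0, fun x hx => hx.1.1⟩
  have hRlt : ∀ {v}, v ∈ R → v < 1 := by
    rintro v ⟨x, hx, -, hvx⟩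
    exact hvx.trans_le hx.2
  have hAne : ∀ {v}, v ∈ R → (A v).Nonempty := by
    rintro v ⟨x, hx, hxv, -⟩
    exact ⟨x, hx, hxv⟩
  -- The assumption `H 1 = 1` keeps `B v` nonempty, so that its `sInf` is a true infimum.
  have hBne : ∀ {v}, v ∈ R → (B v).Nonempty := fun hv =>
    ⟨1, ⟨zero_le_one, le_rfl⟩, (hRlt hv).trans_eq h1.symm⟩
  have ha_mem : ∀ {v}, v ∈ R → sInf (A v) ∈ Ico (0 : ℝ) 1 := by
    intro v hv
    refine ⟨le_csInf (hAne hv) fun x hx => hx.1.1, ?_⟩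
    obtain ⟨x, hx⟩ := hAne hv
    refine (csInf_le (hAbdd v) hx).trans_lt (lt_of_le_of_ne hx.1.2 ?_)
    rintro rfl
    exact (hRlt hv).ne (hx.2 ▸ h1)
  have ha : ∀ {v}, v ∈ R → H (sInf (A v)) = v := by
    intro v hv
    obtain ⟨s, -, hs, hslim, hsA⟩ :=
      (isGLB_csInf (hAne hv) (hAbdd v)).exists_seq_antitone_tendsto (hAne hv)
    have := (hH.2.1 _ (ha_mem hv)).tendsto.comp
      (tendsto_nhdsWithin_iff.2 ⟨hslim, Eventually.of_forall hs⟩)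
    refine tendsto_nhds_unique this ?_
    simp only [Function.comp_def, (hsA _).2]
    exact tendsto_const_nhds
  have hb_mem : ∀ {v}, v ∈ R → sInf (B v) ∈ Icc (0 : ℝ) 1 := fun {v} hv =>
    ⟨le_csInf (hBne hv) fun x hx => hx.1.1,
      csInf_le (hBbdd v) ⟨⟨zero_le_one, le_rfl⟩, (hRlt hv).trans_eq h1.symm⟩⟩
  have hb_ge : ∀ {v}, v ∈ R → ∀ x ∈ Icc (0 : ℝ) 1, H x ≤ v → x ≤ sInf (B v) := by
    intro v hv x hx hxv
    refine le_csInf (hBne hv) fun y hy => le_of_not_gt fun hyx => ?_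
    exact (hmono hy.1 hx hyx.le).not_gt (hxv.trans_lt hy.2)
  -- `H` jumps above `v` at the right end. Otherwise `H` takes values `v' > v` arbitrarily close to
  -- `v` just to the right of `inf B v`. Once `v' < inf B v`, monotonicity gives `H v' ≤ v < v'`, so
  -- strict values accumulate at `v`, against finiteness.
  have hb : ∀ {v}, v ∈ R → v < H (sInf (B v)) := by
    intro v hv
    by_contra! hle
    obtain ⟨x, hx, hxv, hvx⟩ := id hv
    have hxb : x ≤ sInf (B v) := hb_ge hv x hx hxv.le
    have hb1 : sInf (B v) ∈ Ico (0 : ℝ) 1 := by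
      refine ⟨(hb_mem hv).1, lt_of_le_of_ne (hb_mem hv).2 fun h => ?_⟩
      rw [h, h1] at hle
      exact hle.not_gt (hRlt hv)
    have hbv : H (sInf (B v)) = v := le_antisymm hle (hxv.symm.trans_le (hmono hx (hb_mem hv) hxb))
    obtain ⟨s, -, hs, hslim, hsB⟩ :=
      (isGLB_csInf (hBne hv) (hBbdd v)).exists_seq_antitone_tendsto (hBne hv)
    have hlim := (hH.2.1 _ hb1).tendsto.comp
      (tendsto_nhdsWithin_iff.2 ⟨hslim, Eventually.of_forall hs⟩)
    rw [hbv] at hlim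
    have hclosed : (strictFaceValues H \ {v})ᶜ ∈ 𝓝 v :=
      (hfin.subset sdiff_subset).isClosed.isOpen_compl.mem_nhds fun h => h.2 rfl
    obtain ⟨n, hn, hn'⟩ := ((hlim.eventually hclosed).and
      (hlim.eventually (gt_mem_nhds (hvx.trans_le hxb)))).exists
    refine hn ⟨⟨⟨s n, (hsB n).1, rfl⟩, ?_⟩, (hsB n).2.ne'⟩
    refine lt_of_le_of_lt ?_ (hsB n).2
    rw [← hbv]
    exact hmono ⟨(hH.2.2 _ (hsB n).1).1, securities_le_one hH (hsB n).1⟩ (hb_mem hv) hn'.le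
  have hab : ∀ {v}, v ∈ R → sInf (A v) < sInf (B v) := fun {v} hv => by
    refine lt_of_le_of_ne (hb_ge hv _ (Ico_subset_Icc_self (ha_mem hv)) (ha hv).le) fun h => ?_
    exact (hb hv).ne' (h ▸ ha hv)
  have hconst : ∀ {v}, v ∈ R → ∀ x ∈ Ico (sInf (A v)) (sInf (B v)), H x = v := by
    intro v hv x hx
    have hx01 : x ∈ Icc (0 : ℝ) 1 := ⟨(ha_mem hv).1.trans hx.1, hx.2.le.trans (hb_mem hv).2⟩
    refine le_antisymm (le_of_not_gt fun h => ?_)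
      ((ha hv).symm.trans_le (hmono (Ico_subset_Icc_self (ha_mem hv)) hx01 hx.1))
    exact hx.2.not_ge (csInf_le (hBbdd v) ⟨hx01, h⟩)
  have hcount : R.Countable := by
    have hinj : InjOn (fun v => sInf (A v)) R := fun v hv w hw h => by
      rw [← ha hv, ← ha hw]
      exact congrArg H h
    refine countable_of_injective_of_countable_image hinj ?_
    refine PairwiseDisjoint.countable_of_Ioo (y := fun x => sInf (B (H x))) ?_ ?_
    · rintro _ ⟨v, hv, rfl⟩ _ ⟨w, hw, rfl⟩ hne
      refine disjoint_left.2 fun x hx hx' => hne ?_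
      simp only [ha hv, ha hw] at hx hx'
      have := (hconst hv x (Ioo_subset_Ico_self hx)).symm.trans
        (hconst hw x (Ioo_subset_Ico_self hx'))
      rw [this]
    · rintro _ ⟨v, hv, rfl⟩
      simpa only [ha hv] using hab hv
  refine ⟨R, fun v => sInf (A v), fun v => sInf (B v), hcount.to_subtype,
    ⟨hH, fun v => ⟨(ha_mem v.2).1, (ha_mem v.2).2, hab v.2⟩, fun v x hx => ?_, fun x hx hout => ?_,
      fun v w hne => ?_⟩, (encard_le_encard ?_).trans hk⟩
  · rw [hconst v.2 x hx.1, ha v.2]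
  · by_contra hne
    have hlt : H x < x := lt_of_le_of_ne (hH.2.2 x hx).2 hne
    have hv : H x ∈ R := ⟨x, hx, rfl, hlt⟩
    refine hout ⟨H x, hv⟩ ⟨csInf_le (hAbdd _) ⟨hx, rfl⟩, ?_⟩
    refine lt_of_le_of_ne (hb_ge hv x hx le_rfl) fun h => ?_
    have := hb hv
    rw [← h] at this
    exact this.false
  · rw [ha v.2, ha w.2]
    exact fun h => hne (Subtype.ext h)
  · rintro _ ⟨⟨v, hv⟩, rfl, hlt⟩
    have ha01 := Ico_subset_Icc_self (ha_mem hv)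
    have hva : v < sInf (A v) := by
      have := hlt _ ⟨⟨le_rfl, hab hv⟩, ha01⟩
      simpa only [ha hv] using this
    simp only [ha hv]
    refine ⟨⟨_, ha01, ha hv⟩, ?_⟩
    have hv01 : v ∈ Icc (0 : ℝ) 1 := ⟨ha hv ▸ (hH.2.2 _ ha01).1, (hRlt hv).le⟩
    -- If `H v = v`, then `v` would belong to its own level set and could not lie below the left
    -- end.
    refine lt_of_le_of_ne (hH.2.2 v hv01).2 fun h => ?_
    exact hva.not_ge (csInf_le (hAbdd v) ⟨hv01, h⟩)

/-! ### Perturbing a security by tents -/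

/-- The tent of height and half-width `δ` centred at `v`. -/
def tent (v δ w : ℝ) : ℝ := max 0 (δ - |w - v|)

theorem tent_nonneg (v δ w : ℝ) : 0 ≤ tent v δ w := le_max_left _ _

/-- The Lipschitz constant 1 is what keeps `H + t * tent v δ H` nondecreasing for `|t| ≤ 1`. -/
theorem abs_tent_sub_tent_le (v δ w z : ℝ) : |tent v δ w - tent v δ z| ≤ |w - z| := by
  unfold tent
  rw [max_comm 0, max_comm 0]
  refine (abs_max_sub_max_le_abs _ _ (0 : ℝ)).trans ?_
  rw [sub_sub_sub_cancel_left, abs_sub_comm]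
  refine (abs_abs_sub_abs_le_abs_sub _ _).trans_eq ?_
  rw [sub_sub_sub_cancel_right]

theorem continuous_tent (v δ : ℝ) : Continuous (tent v δ) := by
  unfold tent
  fun_prop

theorem tent_pos {v δ w : ℝ} (h : |w - v| < δ) : 0 < tent v δ w :=
  lt_max_of_lt_right (sub_pos.2 h)

theorem tent_eq_zero {v δ w : ℝ} (h : δ ≤ |w - v|) : tent v δ w = 0 :=
  max_eq_left (sub_nonpos.2 h)

theorem tent_le_self {v δ w : ℝ} (hδ : δ ≤ v) (hw : 0 ≤ w) : tent v δ w ≤ w :=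
  max_le hw (by linarith [neg_abs_le (w - v)])

theorem tent_le {v δ w : ℝ} (hδ : 0 ≤ δ) : tent v δ w ≤ δ :=
  max_le hδ (by linarith [abs_nonneg (w - v)])

/-- Where a security takes values close to a strict face value, it stays away from the diagonal. -/
theorem eventually_le_sub_of_mem_strictFaceValues {H : ℝ → ℝ} (hH : H ∈ securities) {v : ℝ}
    (hv : v ∈ strictFaceValues H) :
    ∀ᶠ δ in 𝓝[>] (0 : ℝ), δ ≤ v ∧ ∀ x ∈ Icc (0 : ℝ) 1, |H x - v| < δ → δ ≤ x - H x := by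
  obtain ⟨⟨y, hy, rfl⟩, hlt⟩ := hv
  have hv0 : 0 ≤ H y := (hH.2.2 y hy).1
  have hv1 : H y < 1 := by
    refine lt_of_le_of_ne (securities_le_one hH hy) fun h => ?_
    rw [h] at hlt
    exact (hH.1 hy ⟨zero_le_one, le_rfl⟩ hy.2).not_gt (h ▸ hlt)
  set v := H y
  have hpos : 0 < v := (hH.2.2 v ⟨hv0, hv1.le⟩).1.trans_lt hlt
  -- By right-continuity `H` stays below this midpoint up to some `z > v`. Values of `H` within `δ`
  -- of `v` exceed the midpoint, so they occur only at `x ≥ z`, where `x - H x ≥ z - v - δ ≥ δ`.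
  have hmid : H v < (H v + v) / 2 := by linarith
  have hr := (hH.2.1 v ⟨hv0, hv1⟩).eventually (gt_mem_nhds hmid)
  obtain ⟨z, hz, hz'⟩ := (mem_nhdsGE_iff_exists_Ico_subset).1 hr
  replace hz : v < z := hz
  filter_upwards [Ioo_mem_nhdsGT hpos, Ioo_mem_nhdsGT (show 0 < (z - v) / 2 by linarith),
    Ioo_mem_nhdsGT (show 0 < (v - H v) / 2 by linarith)] with δ h1 h2 h3
  refine ⟨h1.2.le, fun x hx hxv => ?_⟩
  have := abs_lt.1 hxv
  have hmid' : (H v + v) / 2 < H x := by linarith [h3.2]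
  have hzx : z ≤ x := by
    by_contra! hlt'
    rcases le_total x v with hxv | hvx
    · linarith [hH.1 hx ⟨hv0, hv1.le⟩ hxv]
    · have : H x < (H v + v) / 2 := hz' ⟨hvx, hlt'⟩
      linarith
  linarith [h2.2]

/-- A security may be perturbed by small multiples of tents around its strict face values. -/
theorem add_sum_tent_mem_securities {ι : Type*} [Fintype ι] {H : ℝ → ℝ} (hH : H ∈ securities)
    {v : ι → ℝ} {δ : ℝ} (hδ : 0 ≤ δ)
    (hv : ∀ i, δ ≤ v i ∧ ∀ x ∈ Icc (0 : ℝ) 1, |H x - v i| < δ → δ ≤ x - H x)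
    {t : ι → ℝ} (ht : ∑ i, |t i| ≤ 1) :
    (fun x => H x + ∑ i, t i * tent (v i) δ (H x)) ∈ securities := by
  -- One bound serves three times: `c = |H x - H y|` for monotonicity, `c = H x` for nonnegativity,
  -- `c = x - H x` for the upper bound.
  have hbound : ∀ {f : ι → ℝ} {c : ℝ}, (∀ i, |f i| ≤ c) → 0 ≤ c → |∑ i, t i * f i| ≤ c := by
    intro f c hf hc
    calc |∑ i, t i * f i| ≤ ∑ i, |t i| * c := by
          refine (Finset.abs_sum_le_sum_abs _ _).trans (Finset.sum_le_sum fun i _ => ?_)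
          rw [abs_mul]
          exact mul_le_mul_of_nonneg_left (hf i) (abs_nonneg _)
      _ ≤ c := by
          rw [← Finset.sum_mul]
          exact mul_le_of_le_one_left hc ht
  refine ⟨fun x hx y hy hxy => ?_, fun x hx => ?_, fun x hx => ?_⟩
  · have h1 := hH.1 hx hy hxy
    have h2 := hbound (fun i => abs_tent_sub_tent_le (v i) δ (H x) (H y)) (abs_nonneg _)
    simp only [mul_sub, Finset.sum_sub_distrib] at h2
    rw [abs_sub_comm (H x), abs_of_nonneg (sub_nonneg.2 h1)] at h2
    have := (abs_le.1 h2).2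
    dsimp only
    linarith
  · have hc := hH.2.1 x hx
    exact hc.add (tendsto_finsetSum _ fun i _ => tendsto_const_nhds.mul
      ((continuous_tent _ _).continuousAt.comp_continuousWithinAt hc))
  · obtain ⟨h0, h1⟩ := hH.2.2 x hx
    have h2 := hbound (f := fun i => tent (v i) δ (H x)) (c := H x) (fun i => by
      rw [abs_of_nonneg (tent_nonneg _ _ _)]
      exact tent_le_self (hv i).1 h0) h0
    have h3 := hbound (f := fun i => tent (v i) δ (H x)) (c := x - H x) (fun i => by
      rw [abs_of_nonneg (tent_nonneg _ _ _)]
      rcases lt_or_ge |H x - v i| δ with h | h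
      · exact (tent_le hδ).trans ((hv i).2 x hx h)
      · rw [tent_eq_zero h]
        exact sub_nonneg.2 h1) (sub_nonneg.2 h1)
    exact ⟨by dsimp only; linarith [(abs_le.1 h2).1], by dsimp only; linarith [(abs_le.1 h3).2]⟩

theorem exists_injective_fin_of_lt_encard {α : Type*} {s : Set α} {k : ℕ}
    (h : (k : ℕ∞) < s.encard) :
    ∃ v : Fin (k + 1) → α, Function.Injective v ∧ ∀ i, v i ∈ s := by
  obtain ⟨t, hts, ht⟩ := exists_subset_encard_eq (Order.add_one_le_of_lt h)
  have hfin : t.Finite := finite_of_encard_eq_coe (k := k + 1) (by simpa using ht)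
  have hcard : Nat.card t = k + 1 := by
    have := hfin.cast_ncard_eq
    rw [ht] at this
    rw [Nat.card_coe_set_eq]
    exact_mod_cast this
  have : Finite t := hfin
  let e := (Finite.equivFinOfCardEq hcard).symm
  exact ⟨fun i => e i, Subtype.val_injective.comp e.injective, fun i => hts (e i).2⟩

/-- The perturbation of a security by a nontrivial combination of tents around distinct strict
face values is not almost everywhere zero. -/
theorem integral_sum_tent_sq_pos {ι : Type*} [Fintype ι] {H : ℝ → ℝ}
    (hH : H ∈ securities) (h1 : H 1 = 1) {v : ι → ℝ} {δ : ℝ} (hδ : 0 < δ)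
    (hv : ∀ i, v i ∈ strictFaceValues H) (hsep : ∀ i j, i ≠ j → 2 * δ ≤ |v i - v j|)
    {t : ι → ℝ} (ht : t ≠ 0)
    (hint : IntervalIntegrable (fun x => (∑ i, t i * tent (v i) δ (H x)) ^ 2) volume 0 1) :
    0 < ∫ x in (0 : ℝ)..1, (∑ i, t i * tent (v i) δ (H x)) ^ 2 := by
  obtain ⟨j, hj⟩ := Function.ne_iff.1 ht
  obtain ⟨⟨y, hy, hyv⟩, hlt⟩ := hv j
  have hy1 : y < 1 := by
    refine lt_of_le_of_ne hy.2 fun h => ?_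
    rw [← hyv, h, h1, h1] at hlt
    exact hlt.false
  -- Right-continuity at a point where `H` equals `v j` gives an interval on which only the `j`-th
  -- tent is nonzero.
  have hr := (hH.2.1 y ⟨hy.1, hy1⟩).eventually (Metric.ball_mem_nhds _ hδ)
  obtain ⟨z, hz, hz'⟩ := (mem_nhdsGE_iff_exists_mem_Ioc_Ico_subset hy1).1 hr
  have hpos : 0 < ∫ x in y..z, (∑ i, t i * tent (v i) δ (H x)) ^ 2 := by
    refine intervalIntegral.intervalIntegral_pos_of_pos_on (hint.mono_set ?_) (fun x hx => ?_) hz.1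
    · rw [uIcc_of_le hz.1.le, uIcc_of_le zero_le_one]
      exact Icc_subset_Icc hy.1 hz.2
    · have hxj : |H x - v j| < δ := by
        have : H x ∈ Metric.ball (H y) δ := hz' (Ioo_subset_Ico_self hx)
        rwa [Metric.mem_ball, Real.dist_eq, hyv] at this
      rw [Finset.sum_eq_single j]
      · exact sq_pos_of_ne_zero (mul_ne_zero hj (tent_pos hxj).ne')
      · intro i _ hij
        rw [tent_eq_zero, mul_zero]
        have := abs_sub_le (v i) (H x) (v j)
        rw [abs_sub_comm (v i) (H x)] at this
        linarith [hsep i j hij]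
      · simp
  refine hpos.trans_le (intervalIntegral.integral_mono_interval hy.1 hz.1.le hz.2 ?_ hint)
  exact Eventually.of_forall fun x => sq_nonneg _

/-! ### Maximal second moment under linear constraints -/

/-- For a security with the largest second moment among those with the same integrals against `k`
weights, there are at most `k` strict face values. -/
theorem encard_strictFaceValues_le_of_forall_integral_sq_le {k : ℕ} {w : Fin k → ℝ → ℝ}
    (hw : ∀ j, IntervalIntegrable (w j) volume 0 1) {H : ℝ → ℝ} (hH : H ∈ securities)
    (h1 : H 1 = 1)
    (hmax : ∀ G ∈ securities,
      (∀ j, ∫ x in (0 : ℝ)..1, G x * w j x = ∫ x in (0 : ℝ)..1, H x * w j x) →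
      ∫ x in (0 : ℝ)..1, G x * G x ≤ ∫ x in (0 : ℝ)..1, H x * H x) :
    (strictFaceValues H).encard ≤ k := by
  by_contra! hlt
  obtain ⟨v, hinj, hv⟩ := exists_injective_fin_of_lt_encard hlt
  have hev : ∀ᶠ δ in 𝓝[>] (0 : ℝ), 0 < δ ∧
      (∀ i, δ ≤ v i ∧ ∀ x ∈ Icc (0 : ℝ) 1, |H x - v i| < δ → δ ≤ x - H x) ∧
      ∀ i j, i ≠ j → 2 * δ ≤ |v i - v j| := by
    refine (eventually_mem_nhdsWithin (s := Ioi (0 : ℝ))).and ((eventually_all.2 fun i =>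
      eventually_le_sub_of_mem_strictFaceValues hH (hv i)).and
        (eventually_all.2 fun i => eventually_all.2 fun j => ?_))
    by_cases hij : i = j
    · simp [hij]
    · filter_upwards [Ioo_mem_nhdsGT (half_pos (abs_pos.2 (sub_ne_zero.2 (hinj.ne hij))))]
        with δ hδ _
      linarith [hδ.2]
  obtain ⟨δ, hδ, hδv, hsep⟩ := hev.exists
  have hHm := aestronglyMeasurable_of_mem_securities hH
  have htm : ∀ i, AEStronglyMeasurable (fun x => tent (v i) δ (H x)) (volume.restrict (uIoc 0 1)) :=
    fun i => (continuous_tent _ _).comp_aestronglyMeasurable hHm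
  have htle : ∀ i, ∀ x ∈ uIoc (0 : ℝ) 1, ‖tent (v i) δ (H x)‖ ≤ 1 := fun i x hx => by
    have hx' : x ∈ Icc (0 : ℝ) 1 := by
      rw [uIoc_of_le zero_le_one] at hx
      exact Ioc_subset_Icc_self hx
    rw [Real.norm_of_nonneg (tent_nonneg _ _ _)]
    exact (tent_le_self (hδv i).1 (hH.2.2 x hx').1).trans (securities_le_one hH hx')
  have hti : ∀ (i) {f : ℝ → ℝ}, IntervalIntegrable f volume 0 1 →
      IntervalIntegrable (fun x => tent (v i) δ (H x) * f x) volume 0 1 := fun i f hf =>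
    hf.bdd_mul_of_norm_le_one (htm i) (htle i)
  have hsum : ∀ (t : Fin (k + 1) → ℝ) {f : ℝ → ℝ}, IntervalIntegrable f volume 0 1 →
      IntervalIntegrable (fun x => (∑ i, t i * tent (v i) δ (H x)) * f x) volume 0 1 ∧
      ∫ x in (0 : ℝ)..1, (∑ i, t i * tent (v i) δ (H x)) * f x =
        ∑ i, t i * ∫ x in (0 : ℝ)..1, tent (v i) δ (H x) * f x := by
    intro t f hf
    simp_rw [Finset.sum_mul, mul_assoc]
    refine ⟨?_, ?_⟩
    · simpa only [Finset.sum_fn] using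
        IntervalIntegrable.sum Finset.univ fun i _ => (hti i hf).const_mul (t i)
    · rw [intervalIntegral.integral_finsetSum fun i _ => (hti i hf).const_mul (t i)]
      simp_rw [intervalIntegral.integral_const_mul]
  -- Orthogonality to `k` weights is `k` linear equations in `k + 1` coefficients. A nonzero
  -- solution is scaled to `∑ |t i| = 1`, the size admissible for a perturbation.
  let A : Matrix (Fin k) (Fin (k + 1)) ℝ :=
    fun j i => ∫ x in (0 : ℝ)..1, tent (v i) δ (H x) * w j x
  obtain ⟨s, hsA, hs0⟩ := (Submodule.ne_bot_iff _).1
    (LinearMap.ker_ne_bot_of_finrank_lt (f := A.mulVecLin) (by simp))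
  have hs1 : 0 < ∑ i, |s i| := by
    obtain ⟨i, hi⟩ := Function.ne_iff.1 hs0
    exact Finset.sum_pos' (fun _ _ => abs_nonneg _) ⟨i, Finset.mem_univ _, abs_pos.2 hi⟩
  set t : Fin (k + 1) → ℝ := (∑ i, |s i|)⁻¹ • s with ht
  have ht0 : t ≠ 0 := smul_ne_zero (inv_ne_zero hs1.ne') hs0
  have ht1 : ∑ i, |t i| ≤ 1 := by
    simp only [ht, Pi.smul_apply, smul_eq_mul, abs_mul, ← Finset.mul_sum,
      abs_of_pos (inv_pos.2 hs1), inv_mul_cancel₀ hs1.ne', le_refl]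
  have htA : ∀ j, ∫ x in (0 : ℝ)..1, (∑ i, t i * tent (v i) δ (H x)) * w j x = 0 := by
    intro j
    rw [(hsum t (hw j)).2]
    have : A.mulVecLin t = 0 := by
      rw [ht, map_smul, LinearMap.mem_ker.1 hsA, smul_zero]
    have := congrFun this j
    rw [Matrix.mulVecLin_apply, Matrix.mulVec, dotProduct] at this
    simp only [mul_comm (t _)]
    exact this
  set p : ℝ → ℝ := fun x => ∑ i, t i * tent (v i) δ (H x) with hp
  have hHH : IntervalIntegrable H volume 0 1 := by
    simpa using intervalIntegrable_mul_of_mem_securities hH (w := fun _ => 1)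
      intervalIntegrable_const
  have hpi : IntervalIntegrable p volume 0 1 := by
    simpa using (hsum t (f := fun _ => 1) intervalIntegrable_const).1
  have hpp := (hsum t hpi).1
  have hpH := (hsum t hHH).1
  have hHH2 := intervalIntegrable_mul_of_mem_securities hH hHH
  have hplus : (fun x => H x + p x) ∈ securities := add_sum_tent_mem_securities hH hδ.le hδv ht1
  have hminus : (fun x => H x + -p x) ∈ securities := by
    have := add_sum_tent_mem_securities hH hδ.le hδv (t := -t) (by simpa using ht1)
    simpa [hp] using this
  have hle1 := hmax _ hplus fun j => by
    simp_rw [add_mul]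
    rw [intervalIntegral.integral_add (intervalIntegrable_mul_of_mem_securities hH (hw j))
      (hsum t (hw j)).1, htA j, add_zero]
  have hle2 := hmax _ hminus fun j => by
    simp_rw [← sub_eq_add_neg, sub_mul]
    rw [intervalIntegral.integral_sub (intervalIntegrable_mul_of_mem_securities hH (hw j))
      (hsum t (hw j)).1, htA j, sub_zero]
  -- Adding the two expansions cancels the cross terms, so `∫ p² > 0` contradicts `hle1` and `hle2`
  -- together.
  have e1 : ∫ x in (0 : ℝ)..1, (H x + p x) * (H x + p x) =
      (∫ x in (0 : ℝ)..1, H x * H x) + 2 * (∫ x in (0 : ℝ)..1, p x * H x) +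
        ∫ x in (0 : ℝ)..1, p x * p x := by
    rw [← intervalIntegral.integral_const_mul, ← intervalIntegral.integral_add hHH2
      (hpH.const_mul 2), ← intervalIntegral.integral_add (hHH2.add (hpH.const_mul 2)) hpp]
    exact intervalIntegral.integral_congr fun x _ => by ring
  have e2 : ∫ x in (0 : ℝ)..1, (H x + -p x) * (H x + -p x) =
      (∫ x in (0 : ℝ)..1, H x * H x) - 2 * (∫ x in (0 : ℝ)..1, p x * H x) +
        ∫ x in (0 : ℝ)..1, p x * p x := by
    rw [← intervalIntegral.integral_const_mul, ← intervalIntegral.integral_sub hHH2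
      (hpH.const_mul 2), ← intervalIntegral.integral_add (hHH2.sub (hpH.const_mul 2)) hpp]
    exact intervalIntegral.integral_congr fun x _ => by ring
  have hpos := integral_sum_tent_sq_pos hH h1 hδ hv hsep ht0 (by simpa only [pow_two] using hpp)
  simp only [pow_two] at hpos
  linarith

/-- Any security can be replaced by a contingent debt contract with at most `k` non-defaultable
face values that has the same integrals against `k` given weights. -/
theorem exists_isContingentDebt_integral_eq {k : ℕ} {w : Fin k → ℝ → ℝ}
    (hw : ∀ j, IntervalIntegrable (w j) volume 0 1) {H : ℝ → ℝ} (hH : H ∈ securities) :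
    ∃ G ∈ securities, IsContingentDebt G k ∧
      ∀ j, ∫ x in (0 : ℝ)..1, G x * w j x = ∫ x in (0 : ℝ)..1, H x * w j x := by
  set K : Set (ℝ → ℝ) := {G | G ∈ securities ∧
    ∀ j, ∫ x in (0 : ℝ)..1, G x * w j x = ∫ x in (0 : ℝ)..1, H x * w j x} with hK
  set J : (ℝ → ℝ) → ℝ := fun G => ∫ x in (0 : ℝ)..1, G x * G x with hJ
  have hint : ∀ {G}, G ∈ securities → IntervalIntegrable G volume 0 1 := fun hG => by
    simpa using intervalIntegrable_mul_of_mem_securities hG (w := fun _ => 1)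
      intervalIntegrable_const
  have hbdd : BddAbove (J '' K) := by
    refine ⟨1, ?_⟩
    rintro _ ⟨G, hG, rfl⟩
    have : J G ≤ ∫ _ in (0 : ℝ)..1, (1 : ℝ) := by
      refine intervalIntegral.integral_mono_on zero_le_one
        (intervalIntegrable_mul_of_mem_securities hG.1 (hint hG.1)) intervalIntegrable_const
        fun x hx => ?_
      exact mul_le_one₀ (securities_le_one hG.1 hx) (hG.1.2.2 x hx).1 (securities_le_one hG.1 hx)
    simpa using this
  obtain ⟨a, -, ha, haK⟩ := exists_seq_tendsto_sSup (S := J '' K)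
    ⟨_, H, ⟨hH, fun _ => rfl⟩, rfl⟩ hbdd
  choose u hu hua using haK
  obtain ⟨F, hF, ψ, hψ, hlim⟩ := exists_subseq_tendsto_of_mem_securities fun n => (hu n).1
  have hFw : ∀ j, ∫ x in (0 : ℝ)..1, F x * w j x = ∫ x in (0 : ℝ)..1, H x * w j x := fun j => by
    refine tendsto_nhds_unique (tendsto_integral_mul_of_mem_securities (fun n => (hu (ψ n)).1) hlim
      (w := fun _ => w j) (v := w j) (fun _ => hw j) (hw j).norm (fun _ _ _ => le_rfl)
      fun _ _ => tendsto_const_nhds) ?_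
    simp only [fun n => (hu (ψ n)).2 j]
    exact tendsto_const_nhds
  have hJF : J F = sSup (J '' K) := by
    refine tendsto_nhds_unique ?_ (ha.comp hψ.tendsto_atTop)
    have h2 : Tendsto (fun n => J (u (ψ n))) atTop (𝓝 (J F)) := by
      refine intervalIntegral.tendsto_integral_filter_of_dominated_convergence (fun _ => 1)
        (Eventually.of_forall fun n => (intervalIntegrable_mul_of_mem_securities (hu (ψ n)).1
          (hint (hu (ψ n)).1)).aestronglyMeasurable_restrict_uIoc)
        (Eventually.of_forall fun n => Eventually.of_forall fun x hx => ?_)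
        intervalIntegrable_const ?_
      · rw [norm_mul]
        exact mul_le_one₀ (norm_le_one_of_mem_securities (hu (ψ n)).1 hx) (norm_nonneg _)
          (norm_le_one_of_mem_securities (hu (ψ n)).1 hx)
      · filter_upwards [hlim] with x hx hx1 using (hx hx1).mul (hx hx1)
    simpa only [Function.comp_def, hua] using h2
  -- Raising the value at the single point `1` changes no integral, and right-continuity is only
  -- required on `[0, 1)`.
  set G : ℝ → ℝ := Function.update F 1 1 with hG
  have hG1 : G 1 = 1 := Function.update_self ..
  have hGF : ∀ x, x ≠ 1 → G x = F x := fun x hx => Function.update_of_ne hx ..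
  have hae : ∀ f : ℝ → ℝ → ℝ, ∫ x in (0 : ℝ)..1, f (G x) x = ∫ x in (0 : ℝ)..1, f (F x) x := by
    intro f
    refine intervalIntegral.integral_congr_ae ?_
    filter_upwards [(countable_singleton (1 : ℝ)).ae_notMem volume] with x hx _
    rw [hGF x hx]
  have hGs : G ∈ securities := by
    have hGle : ∀ x ∈ Icc (0 : ℝ) 1, 0 ≤ G x ∧ G x ≤ x := fun x hx => by
      rcases eq_or_ne x 1 with rfl | h
      · simp [hG1]
      · rw [hGF x h]
        exact hF.2.2 x hx
    refine ⟨fun x hx y hy hxy => ?_, fun x hx => ?_, hGle⟩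
    · rcases eq_or_ne y 1 with rfl | h
      · rw [hG1]
        exact (hGle x hx).2.trans hx.2
      · have : x ≠ 1 := fun hx1 => h (le_antisymm hy.2 (hx1 ▸ hxy))
        rw [hGF x this, hGF y h]
        exact hF.1 hx hy hxy
    · refine (hF.2.1 x hx).congr_of_eventuallyEq ?_ (hGF x hx.2.ne)
      filter_upwards [mem_nhdsWithin_of_mem_nhds (Iio_mem_nhds hx.2)] with y hy
      exact hGF y (ne_of_lt hy)
  refine ⟨G, hGs, isContingentDebt_of_encard_strictFaceValues_le hGs hG1
    (encard_strictFaceValues_le_of_forall_integral_sq_le hw hGs hG1 fun G' hG' h => ?_),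
    fun j => (hae fun y x => y * w j x).trans (hFw j)⟩
  rw [hae fun y _ => y * y]
  have : J G' ≤ sSup (J '' K) := le_csSup hbdd ⟨G', ⟨hG', fun j => (h j).trans
    ((hae fun y x => y * w j x).trans (hFw j))⟩, rfl⟩
  exact this.trans_eq hJF.symm

/-! ### Signs of derivatives and functions whose critical points are maxima -/

theorem HasDerivWithinAt.nonneg_of_forall_le_Icc_right {f : ℝ → ℝ} {f' c b : ℝ}
    (h : HasDerivWithinAt f f' (Icc c b) c) (hcb : c < b) (hle : ∀ x ∈ Icc c b, f c ≤ f x) :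
    0 ≤ f' := by
  have h' := hasDerivWithinAt_iff_tendsto_slope.1 h
  rw [Icc_sdiff_left, nhdsWithin_Ioc_eq_nhdsGT hcb] at h'
  refine ge_of_tendsto h' ?_
  filter_upwards [Ioc_mem_nhdsGT hcb] with x hx
  rw [slope_def_field]
  exact div_nonneg (sub_nonneg.2 (hle x (Ioc_subset_Icc_self hx))) (sub_nonneg.2 hx.1.le)

theorem HasDerivWithinAt.nonneg_of_forall_le_Icc_left {f : ℝ → ℝ} {f' a c : ℝ}
    (h : HasDerivWithinAt f f' (Icc a c) c) (hac : a < c) (hle : ∀ x ∈ Icc a c, f x ≤ f c) :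
    0 ≤ f' := by
  have h' := hasDerivWithinAt_iff_tendsto_slope.1 h
  rw [Icc_sdiff_right, nhdsWithin_Ico_eq_nhdsLT hac] at h'
  refine ge_of_tendsto h' ?_
  filter_upwards [Ico_mem_nhdsLT hac] with x hx
  rw [slope_def_field]
  exact div_nonneg_of_nonpos (sub_nonpos.2 (hle x (Ico_subset_Icc_self hx)))
    (sub_nonpos.2 hx.2.le)

/-- If all critical points of `f` on `[a, b]` are global maxima, then `f` is minimal at `o` on the
segment between a critical point and `o`. -/
theorem le_of_mem_uIcc_of_forall_critical_isMax {f f' : ℝ → ℝ} {a b : ℝ}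
    (hf : ∀ x ∈ Icc a b, HasDerivWithinAt f (f' x) (Icc a b) x)
    (hcrit : ∀ x ∈ Icc a b, f' x = 0 → ∀ y ∈ Icc a b, f y ≤ f x)
    {c o : ℝ} (hc : c ∈ Icc a b) (ho : o ∈ Icc a b) (hfc : f' c = 0) :
    ∀ x ∈ uIcc c o, f o ≤ f x := by
  have hsub : uIcc c o ⊆ Icc a b := ordConnected_Icc.uIcc_subset hc ho
  have hcont : ContinuousOn f (uIcc c o) :=
    ContinuousOn.mono (fun x hx => (hf x hx).continuousWithinAt) hsub
  obtain ⟨m, hm, hmin⟩ := isCompact_uIcc.exists_isMinOn nonempty_uIcc hcont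
  intro x hx
  refine le_trans ?_ (hmin hx)
  by_cases hmo : m = o
  · exact hmo ▸ le_rfl
  -- A minimizer `m ≠ o` on the segment is either `c` or an interior critical point, hence a global
  -- maximum.
  have hcm : f c ≤ f m := by
    by_cases hmc : m = c
    · exact hmc ▸ le_rfl
    have hnhds : uIcc c o ∈ 𝓝 m := by
      rcases le_total c o with hco | hco
      · rw [uIcc_of_le hco] at hm ⊢
        exact Icc_mem_nhds (lt_of_le_of_ne hm.1 (Ne.symm hmc)) (lt_of_le_of_ne hm.2 hmo)
      · rw [uIcc_of_ge hco] at hm ⊢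
        exact Icc_mem_nhds (lt_of_le_of_ne hm.1 (Ne.symm hmo)) (lt_of_le_of_ne hm.2 hmc)
    exact hcrit m (hsub hm) ((hmin.isLocalMin hnhds).hasDerivAt_eq_zero
      ((hf m (hsub hm)).hasDerivAt (mem_of_superset hnhds hsub))) c hc
  exact (hcrit c hc hfc o ho).trans hcm

theorem id_mem_securities : (fun x : ℝ => x) ∈ securities :=
  ⟨monotone_id.monotoneOn _, fun _ _ => continuousWithinAt_id, fun _ hx => ⟨hx.1, le_rfl⟩⟩

/-! ### The effort problem and existence of a solution -/

namespace MoralHazard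

variable (M : MoralHazard)

theorem intervalIntegrable_φ {e : ℝ} (he : e ∈ Icc 0 M.ebar) :
    IntervalIntegrable (M.φ e) volume 0 1 :=
  (intervalIntegrable_iff_integrableOn_Icc_of_le zero_le_one).2 (M.φ_integrable e he)

/-- The derivative of the density in effort is dominated, and the density is Lipschitz in
effort. -/
theorem exists_bound : ∃ g : ℝ → ℝ, IntervalIntegrable g volume 0 1 ∧
    (∀ e ∈ Icc 0 M.ebar, ∀ x ∈ uIoc (0 : ℝ) 1, ‖M.φe e x‖ ≤ g x) ∧
    ∀ e ∈ Icc 0 M.ebar, ∀ e' ∈ Icc 0 M.ebar, ∀ x ∈ uIoc (0 : ℝ) 1,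
      ‖M.φ e' x - M.φ e x‖ ≤ g x * ‖e' - e‖ := by
  obtain ⟨g, hg, hle⟩ := M.φ_dominated
  rw [uIoc_of_le zero_le_one]
  refine ⟨g, (intervalIntegrable_iff_integrableOn_Icc_of_le zero_le_one).2 hg,
    fun e he x hx => hle e he x (Ioc_subset_Icc_self hx), fun e he e' he' x hx => ?_⟩
  exact (convex_Icc 0 M.ebar).norm_image_sub_le_of_norm_derivWithin_le
    (M.φ_differentiable x (Ioc_subset_Icc_self hx))
    (fun e he => hle e he x (Ioc_subset_Icc_self hx)) he he'

theorem tendsto_slope_φ {e x : ℝ} (he : e ∈ Icc 0 M.ebar) (hx : x ∈ uIoc (0 : ℝ) 1) :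
    Tendsto (slope (fun t => M.φ t x) e) (𝓝[Icc 0 M.ebar \ {e}] e) (𝓝 (M.φe e x)) := by
  rw [uIoc_of_le zero_le_one] at hx
  exact hasDerivWithinAt_iff_tendsto_slope.1
    (M.φ_differentiable x (Ioc_subset_Icc_self hx) e he).hasDerivWithinAt

theorem neBot_nhdsWithin_diff {e : ℝ} (he : e ∈ Icc 0 M.ebar) :
    (𝓝[Icc 0 M.ebar \ {e}] e).NeBot := by
  have := (uniqueDiffOn_Icc M.ebar_pos e he).accPt
  rwa [accPt_principal_iff_nhdsWithin] at this

/-- Measurability comes from writing `φe e` as a limit of difference quotients along a sequence of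
efforts. -/
theorem intervalIntegrable_φe {e : ℝ} (he : e ∈ Icc 0 M.ebar) :
    IntervalIntegrable (M.φe e) volume 0 1 := by
  obtain ⟨g, hg, hle, -⟩ := M.exists_bound
  have := M.neBot_nhdsWithin_diff he
  obtain ⟨s, hs, hs'⟩ := exists_seq_forall_of_frequently
    (eventually_mem_nhdsWithin (a := e) (s := Icc 0 M.ebar \ {e})).frequently
  refine hg.mono_fun' (aestronglyMeasurable_of_tendsto_ae atTop
    (f := fun n x => slope (fun t => M.φ t x) e (s n)) (fun n => ?_) ?_) ?_
  · simp only [slope_def_field]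
    exact (((M.intervalIntegrable_φ (hs' n).1).sub
      (M.intervalIntegrable_φ he)).div_const _).aestronglyMeasurable_restrict_uIoc
  · filter_upwards [ae_restrict_mem measurableSet_uIoc] with x hx
    exact (M.tendsto_slope_φ he hx).comp hs
  · filter_upwards [ae_restrict_mem measurableSet_uIoc] with x hx using hle e he x hx

/-- The derivative of the payoff in effort. -/
noncomputable def marginalPayoff (H : ℝ → ℝ) (e : ℝ) : ℝ :=
  (∫ x in (0 : ℝ)..1, (x - H x) * M.φe e x) - M.C' e

theorem FOC_iff {H : ℝ → ℝ} {e : ℝ} : M.FOC H e ↔ M.marginalPayoff H e = 0 :=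
  sub_eq_zero.symm

/-- Differentiation under the integral: the Lipschitz bound in effort dominates all difference
quotients by `g`. -/
theorem hasDerivWithinAt_payoff {H : ℝ → ℝ} (hH : H ∈ securities) {e : ℝ}
    (he : e ∈ Icc 0 M.ebar) :
    HasDerivWithinAt (M.payoff H) (M.marginalPayoff H e) (Icc 0 M.ebar) e := by
  refine HasDerivWithinAt.sub ?_ (M.C_differentiable e he).hasDerivWithinAt
  obtain ⟨g, hg, hle, hlip⟩ := M.exists_bound
  rw [hasDerivWithinAt_iff_tendsto_slope]
  have hslope : ∀ y ∈ Icc 0 M.ebar \ {e}, ∀ x,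
      (x - H x) * slope (fun t => M.φ t x) e y =
        (y - e)⁻¹ * ((x - H x) * M.φ y x - (x - H x) * M.φ e x) := fun y _ x => by
    rw [slope_def_field, div_eq_inv_mul]
    ring
  have hi : ∀ y ∈ Icc 0 M.ebar,
      IntervalIntegrable (fun x => (x - H x) * M.φ y x) volume 0 1 := fun y hy =>
    intervalIntegrable_sub_mul_of_mem_securities hH (M.intervalIntegrable_φ hy)
  have key : Tendsto (fun y => ∫ x in (0 : ℝ)..1, (x - H x) * slope (fun t => M.φ t x) e y)
      (𝓝[Icc 0 M.ebar \ {e}] e) (𝓝 (∫ x in (0 : ℝ)..1, (x - H x) * M.φe e x)) := by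
    refine intervalIntegral.tendsto_integral_filter_of_dominated_convergence g ?_ ?_ hg ?_
    · filter_upwards [self_mem_nhdsWithin] with y hy
      simp only [hslope y hy]
      exact (((hi y hy.1).sub (hi e he)).const_mul _).aestronglyMeasurable_restrict_uIoc
    · filter_upwards [self_mem_nhdsWithin] with y hy
      refine Eventually.of_forall fun x hx => ?_
      rw [norm_mul]
      refine (mul_le_of_le_one_left (norm_nonneg _)
        (norm_sub_le_one_of_mem_securities hH hx)).trans ?_
      rw [slope_def_field, norm_div, div_le_iff₀ (norm_pos_iff.2 (sub_ne_zero.2 hy.2))]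
      exact hlip e he y hy.1 x hx
    · exact Eventually.of_forall fun x hx => (M.tendsto_slope_φ he hx).const_mul _
  refine key.congr' ?_
  filter_upwards [self_mem_nhdsWithin] with y hy
  simp only [hslope y hy]
  rw [intervalIntegral.integral_const_mul, intervalIntegral.integral_sub (hi y hy.1) (hi e he),
    slope_def_field, div_eq_inv_mul]

/-- The Lipschitz bound gives the common majorant `|φ e₀| + ebar * g` for all the densities `φ (e
n)`. -/
theorem tendsto_integral_mul_φ {u : ℕ → ℝ → ℝ} {F : ℝ → ℝ} {e : ℕ → ℝ} {e₀ : ℝ}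
    (he : ∀ n, e n ∈ Icc 0 M.ebar) (he₀ : e₀ ∈ Icc 0 M.ebar) (hlime : Tendsto e atTop (𝓝 e₀))
    (hu : ∀ n, u n ∈ securities)
    (hlim : ∀ᵐ x, x ∈ uIoc (0 : ℝ) 1 → Tendsto (fun n => u n x) atTop (𝓝 (F x))) :
    Tendsto (fun n => ∫ x in (0 : ℝ)..1, u n x * M.φ (e n) x) atTop
      (𝓝 (∫ x in (0 : ℝ)..1, F x * M.φ e₀ x)) := by
  obtain ⟨g, hg, hle, hlip⟩ := M.exists_bound
  refine tendsto_integral_mul_of_mem_securities hu hlim (fun n => M.intervalIntegrable_φ (he n))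
    ((M.intervalIntegrable_φ he₀).norm.add (hg.mul_const M.ebar)) (fun n x hx => ?_)
    fun x hx => ?_
  · refine (norm_le_norm_add_norm_sub' _ _).trans (add_le_add_right
      ((hlip _ he₀ _ (he n) x hx).trans (mul_le_mul_of_nonneg_left ?_
        ((norm_nonneg _).trans (hle e₀ he₀ x hx)))) _)
    rw [Real.norm_eq_abs, abs_le]
    constructor <;> linarith [(he n).1, (he n).2, he₀.1, he₀.2]
  · have hx' : x ∈ Icc (0 : ℝ) 1 := by
      rw [uIoc_of_le zero_le_one] at hx
      exact Ioc_subset_Icc_self hx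
    exact ((M.φ_differentiable x hx' e₀ he₀).continuousWithinAt.tendsto.comp
      (tendsto_nhdsWithin_iff.2 ⟨hlime, Eventually.of_forall he⟩))

theorem tendsto_payoff {u : ℕ → ℝ → ℝ} {F : ℝ → ℝ} (hu : ∀ n, u n ∈ securities)
    (hF : F ∈ securities)
    (hlim : ∀ᵐ x, x ∈ uIoc (0 : ℝ) 1 → Tendsto (fun n => u n x) atTop (𝓝 (F x)))
    {e : ℕ → ℝ} {e₀ : ℝ} (he : ∀ n, e n ∈ Icc 0 M.ebar)
    (he₀ : e₀ ∈ Icc 0 M.ebar) (hlime : Tendsto e atTop (𝓝 e₀)) :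
    Tendsto (fun n => M.payoff (u n) (e n)) atTop (𝓝 (M.payoff F e₀)) := by
  simp only [payoff, intervalIntegral_sub_mul_of_mem_securities hF (M.intervalIntegrable_φ he₀),
    fun n => intervalIntegral_sub_mul_of_mem_securities (hu n) (M.intervalIntegrable_φ (he n))]
  refine ((M.tendsto_integral_mul_φ he he₀ hlime (fun _ => id_mem_securities)
    (Eventually.of_forall fun _ _ => tendsto_const_nhds)).sub
    (M.tendsto_integral_mul_φ he he₀ hlime hu hlim)).sub ?_
  exact (M.C_differentiable e₀ he₀).continuousWithinAt.tendsto.comp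
    (tendsto_nhdsWithin_iff.2 ⟨hlime, Eventually.of_forall he⟩)

/-- The effort is held fixed, because `φe` is not assumed continuous in effort. -/
theorem tendsto_marginalPayoff {u : ℕ → ℝ → ℝ} {F : ℝ → ℝ} (hu : ∀ n, u n ∈ securities)
    (hF : F ∈ securities)
    (hlim : ∀ᵐ x, x ∈ uIoc (0 : ℝ) 1 → Tendsto (fun n => u n x) atTop (𝓝 (F x)))
    {e : ℝ} (he : e ∈ Icc 0 M.ebar) :
    Tendsto (fun n => M.marginalPayoff (u n) e) atTop (𝓝 (M.marginalPayoff F e)) := by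
  have hi := M.intervalIntegrable_φe he
  simp only [marginalPayoff, intervalIntegral_sub_mul_of_mem_securities hF hi,
    fun n => intervalIntegral_sub_mul_of_mem_securities (hu n) hi]
  exact ((tendsto_integral_mul_of_mem_securities hu hlim (fun _ => hi) hi.norm
    (fun _ _ _ => le_rfl) fun _ _ => tendsto_const_nhds).const_sub _).sub_const _

/-- If the first-order approach is valid, the constraints are preserved in the limit. -/
theorem feasible_of_tendsto {u : ℕ → ℝ → ℝ} {F : ℝ → ℝ} (hu : ∀ n, u n ∈ securities)
    (hF : F ∈ securities)
    (hlim : ∀ᵐ x, x ∈ uIoc (0 : ℝ) 1 → Tendsto (fun n => u n x) atTop (𝓝 (F x)))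
    (hfoa : ∀ H ∈ securities, ∀ e ∈ Icc 0 M.ebar, M.FOC H e → M.SolvesEffort H e)
    {e : ℕ → ℝ} {e₀ : ℝ} (hfeas : ∀ n, M.Feasible (u n) (e n))
    (hlime : Tendsto e atTop (𝓝 e₀)) : M.Feasible F e₀ := by
  have he : ∀ n, e n ∈ Icc 0 M.ebar := fun n => (hfeas n).2.1
  have he₀ : e₀ ∈ Icc 0 M.ebar := isClosed_Icc.mem_of_tendsto hlime (Eventually.of_forall he)
  have h0 : (0 : ℝ) ∈ Icc 0 M.ebar := ⟨le_rfl, M.ebar_pos.le⟩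
  have h1 : M.ebar ∈ Icc 0 M.ebar := ⟨M.ebar_pos.le, le_rfl⟩
  have hmin : ∀ n, ∀ o ∈ Icc 0 M.ebar, ∀ x ∈ uIcc (e n) o,
      M.payoff (u n) o ≤ M.payoff (u n) x := fun n o ho =>
    le_of_mem_uIcc_of_forall_critical_isMax (fun x hx => M.hasDerivWithinAt_payoff (hu n) hx)
      (fun x hx h => (hfoa _ (hu n) x hx (M.FOC_iff.2 h)).2) (he n) ho
      (M.FOC_iff.1 (hfeas n).2.2.1)
  have hmax : ∀ x ∈ Icc 0 M.ebar, M.payoff F x ≤ M.payoff F e₀ := fun x hx =>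
    le_of_tendsto_of_tendsto' (M.tendsto_payoff hu hF hlim (fun _ => hx) hx tendsto_const_nhds)
      (M.tendsto_payoff hu hF hlim he he₀ hlime)
      fun n => (hfoa _ (hu n) _ (he n) (hfeas n).2.2.1).2 x hx
  have hderiv := M.hasDerivWithinAt_payoff hF he₀
  refine ⟨hF, he₀, M.FOC_iff.2 (le_antisymm ?_ ?_),
    ge_of_tendsto' (M.tendsto_integral_mul_φ he he₀ hlime hu hlim) fun n => (hfeas n).2.2.2⟩
  · rcases he₀.2.lt_or_eq with hlt | heq
    · exact neg_nonneg.1 ((hderiv.neg.mono (Icc_subset_Icc_left he₀.1)).nonneg_of_forall_le_Icc_right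
        hlt fun x hx => neg_le_neg (hmax x ⟨he₀.1.trans hx.1, hx.2⟩))
    -- At the end point `ebar`, maximality of `e₀` gives only the sign `≥ 0`. For the other sign,
    -- the payoff of `u n` on `[e n, ebar]` is minimal at `ebar`, so its marginal payoff there is `≤
    -- 0`, and at this fixed effort it converges. The end point `0` is symmetric.
    · rw [heq]
      refine le_of_tendsto' (M.tendsto_marginalPayoff hu hF hlim h1) fun n => ?_
      rcases (he n).2.lt_or_eq with hlt | heq
      · exact neg_nonneg.1 (((M.hasDerivWithinAt_payoff (hu n) h1).neg.mono
          (Icc_subset_Icc_left (he n).1)).nonneg_of_forall_le_Icc_left hlt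
          fun x hx => neg_le_neg (hmin n _ h1 x (Icc_subset_uIcc hx)))
      · exact (heq ▸ M.FOC_iff.1 (hfeas n).2.2.1).le
  · rcases he₀.1.lt_or_eq with hlt | heq
    · exact (hderiv.mono (Icc_subset_Icc_right he₀.2)).nonneg_of_forall_le_Icc_left
        hlt fun x hx => hmax x ⟨hx.1, hx.2.trans he₀.2⟩
    · rw [← heq]
      refine ge_of_tendsto' (M.tendsto_marginalPayoff hu hF hlim h0) fun n => ?_
      rcases (he n).1.lt_or_eq with hlt | heq
      · exact ((M.hasDerivWithinAt_payoff (hu n) h0).mono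
          (Icc_subset_Icc_right (he n).2)).nonneg_of_forall_le_Icc_right hlt
          fun x hx => hmin n _ h0 x (Icc_subset_uIcc' hx)
      · have := M.FOC_iff.1 (hfeas n).2.2.1
        rw [← heq] at this
        exact this.ge

theorem payoff_le_one {H : ℝ → ℝ} (hH : H ∈ securities) {e : ℝ} (he : e ∈ Icc 0 M.ebar) :
    M.payoff H e ≤ 1 := by
  have : ∫ x in (0 : ℝ)..1, (x - H x) * M.φ e x ≤ ∫ x in (0 : ℝ)..1, M.φ e x := by
    refine intervalIntegral.integral_mono_on zero_le_one
      (intervalIntegrable_sub_mul_of_mem_securities hH (M.intervalIntegrable_φ he))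
      (M.intervalIntegrable_φ he) fun x hx => ?_
    refine mul_le_of_le_one_left (M.φ_pos e he x hx).le ?_
    linarith [(hH.2.2 x hx).1, hx.2]
  rw [M.φ_integral e he] at this
  unfold payoff
  linarith [M.C_nonneg e he]

/-- If the first-order approach is valid and the constraints can be met, the entrepreneur's
problem has a solution. -/
theorem exists_solves
    (hfoa : ∀ H ∈ securities, ∀ e ∈ Icc 0 M.ebar, M.FOC H e → M.SolvesEffort H e)
    (hfeas : ∃ H e, M.Feasible H e) : ∃ H e, M.Solves H e := by
  set P : Set ℝ := {p | ∃ H e, M.Feasible H e ∧ M.payoff H e = p} with hP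
  have hbdd : BddAbove P := ⟨1, by
    rintro _ ⟨H, e, h, rfl⟩
    exact M.payoff_le_one h.1 h.2.1⟩
  obtain ⟨H, e, h⟩ := hfeas
  obtain ⟨p, -, hp, hpP⟩ := exists_seq_tendsto_sSup (S := P) ⟨_, H, e, h, rfl⟩ hbdd
  choose u ε hu hup using hpP
  obtain ⟨F, hF, ψ, hψ, hlim⟩ := exists_subseq_tendsto_of_mem_securities fun n => (hu n).1
  obtain ⟨e₀, he₀, χ, hχ, hlime⟩ := isCompact_Icc.tendsto_subseq fun n => (hu (ψ n)).2.1
  have hlim' : ∀ᵐ x, x ∈ uIoc (0 : ℝ) 1 →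
      Tendsto (fun n => u (ψ (χ n)) x) atTop (𝓝 (F x)) := by
    filter_upwards [hlim] with x hx hx1 using (hx hx1).comp hχ.tendsto_atTop
  refine ⟨F, e₀, M.feasible_of_tendsto (fun n => (hu (ψ (χ n))).1) hF hlim' hfoa
    (fun n => hu (ψ (χ n))) hlime, fun H' e' h' => ?_⟩
  have h1 := M.tendsto_payoff (fun n => (hu (ψ (χ n))).1) hF hlim' (fun n => (hu (ψ (χ n))).2.1)
    he₀ hlime
  have h2 := hp.comp (hψ.comp hχ).tendsto_atTop
  simp only [Function.comp_def, hup] at h1 h2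
  exact (le_csSup hbdd ⟨H', e', h', rfl⟩).trans_eq (tendsto_nhds_unique h2 h1)

end MoralHazard

/-! ### Replacing an optimal security by contingent debt -/

theorem proposition3 (M : MoralHazard)
    (hfoa : ∀ H ∈ securities, ∀ e ∈ Icc 0 M.ebar, M.FOC H e → M.SolvesEffort H e)
    (hfeas : ∃ H e, M.Feasible H e) :
    ∃ H e, IsContingentDebt H 2 ∧ M.Solves H e := by
  obtain ⟨H, e, ⟨hH, he, hfoc, hinv⟩, hopt⟩ := M.exists_solves hfoa hfeas
  have hφ := M.intervalIntegrable_φ he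
  have hφe := M.intervalIntegrable_φe he
  -- The weight `φ e` preserves the payoff and the financing constraint, and `φe e` the FOC; these
  -- two weights account for the two face values.
  obtain ⟨G, hG, hdebt, hint⟩ := exists_isContingentDebt_integral_eq (w := ![M.φ e, M.φe e])
    (by simp [Fin.forall_fin_two, hφ, hφe]) hH
  have h1 : ∫ x in (0 : ℝ)..1, G x * M.φ e x = ∫ x in (0 : ℝ)..1, H x * M.φ e x := hint 0
  have h2 : ∫ x in (0 : ℝ)..1, G x * M.φe e x = ∫ x in (0 : ℝ)..1, H x * M.φe e x := hint 1
  refine ⟨G, e, hdebt, ⟨hG, he, ?_, hinv.trans_eq h1.symm⟩, fun H' e' h' =>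
    (hopt H' e' h').trans_eq ?_⟩
  · unfold MoralHazard.FOC at hfoc ⊢
    rw [intervalIntegral_sub_mul_of_mem_securities hG hφe, h2,
      ← intervalIntegral_sub_mul_of_mem_securities hH hφe, hfoc]
  · unfold MoralHazard.payoff
    rw [intervalIntegral_sub_mul_of_mem_securities hG hφ, h1,
      ← intervalIntegral_sub_mul_of_mem_securities hH hφ]
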